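/- Let $\Lambda\subseteq\mathbb R^d$ be compact with diameter $\rho$, let $\mu$ be a Borel probability measure on $\Lambda$, and let $F:\Lambda\to\Lambda$ be an invertible, $\mu$-preserving, ergodic map ($F$ is not assumed continuous). Call a pair $(x,x')$ of distinct points of $\Lambda$ strongly homoclinic if $\sum_{i\in\mathbb Z}|F^ix-F^ix'|<\infty$. Suppose that $F$ admits a homoclinic coupling, that is, on some probability space there are $\Lambda$-valued random vectors $X,X'$, each with distribution $\mu$, such that $(X,X')$ is strongly homoclinic with positive probability. Let $\eta$ be a probability measure on $\mathbb R^d$ that has a density $f\ge 0$ with respect to Lebesgue measure; put $S=\{v: f(v)>0\}$, $\partial S=\overline S\setminus S^{o}$ and, for $r>0$, $(\partial S)^r=\{u: |u-v|<r\text{ for some }v\in\partial S\}$. Suppose that $$\limsup_{|z|\to0}\frac1{|z|}\int_{S\cap(S-z)}\left|\log\frac{f(w+z)}{f(w)}\right|f(w)\,dw<\infty,\qquad \limsup_{r\searrow0}\frac1r\,\eta\big((\partial S)^r\big)<\infty,\qquad S\supseteq\{u:|u|<3\rho/2\}.$$ Let $X$ have distribution $\mu$, let $(\varepsilon_i)_{i\in\mathbb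 Z}$ be i.i.d. with distribution $\eta$ and independent of $X$, and set $X_i=F^iX$, $Y_i=X_i+\varepsilon_i$ for $i\in\mathbb Z$. Then for no family of measurable maps $\psi_{n,i}:(\mathbb R^d)^n\to\mathbb R^d$ ($n\ge1$, $1\le i\le n$) does one have $$E\left[\frac1n\sum_{i=1}^n\big|\psi_{n,i}(Y_1,\dots,Y_n)-X_i\big|\right]\to0\qquad(n\to\infty);$$ that is, no denoising procedure is weakly consistent for the process $\{(X_i,Y_i)\}$. -/

import Mathlib

open MeasureTheory ProbabilityTheory Filter Topology

/-- `d`-dimensional Euclidean space. -/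
abbrev Euc (d : ℕ) : Type := EuclideanSpace ℝ (Fin d)

section Noise

variable {d : ℕ}

/-- `f` is (a Borel version of) the density of `η` with respect to Lebesgue measure. -/
structure IsLebesgueDensity (η : Measure (Euc d)) (f : Euc d → ℝ) : Prop where
  measurable : Measurable f
  nonneg : ∀ v, 0 ≤ f v
  eq_withDensity : η = (volume : Measure (Euc d)).withDensity (fun v => ENNReal.ofReal (f v))

/-- The support `S = {v : f v > 0}` of a density. -/
def densitySupport (f : Euc d → ℝ) : Set (Euc d) := {v | 0 < f v}

/-- `log f` is Lipschitz on average: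
`limsup_{|z| → 0} |z|⁻¹ ∫_{S ∩ (S - z)} |log (f (w + z) / f w)| f w dw < ∞`.
All quantities take values in `[0, ∞]`. -/
def LogLipschitzOnAverage (f : Euc d → ℝ) : Prop :=
  limsup (fun z : Euc d =>
      (∫⁻ w in densitySupport f ∩ {w | w + z ∈ densitySupport f},
        ENNReal.ofReal (|Real.log (f (w + z) / f w)| * f w)) / ENNReal.ofReal ‖z‖)
    (𝓝[≠] 0) < ⊤

/-- `limsup_{r ↓ 0} r⁻¹ η ((∂S)^r) < ∞`, where `(∂S)^r` is the open `r`-neighbourhood of the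
topological boundary of `S`. -/
def BoundaryMassLinear (η : Measure (Euc d)) (f : Euc d → ℝ) : Prop :=
  limsup (fun r : ℝ =>
      η (Metric.thickening r (frontier (densitySupport f))) / ENNReal.ofReal r)
    (𝓝[>] 0) < ⊤

/-- `S` contains the open ball about the origin of radius `3 ρ / 2`, `ρ = diam Λ`. -/
def SupportContainsBall (Λ : Set (Euc d)) (f : Euc d → ℝ) : Prop :=
  Metric.ball (0 : Euc d) (3 * Metric.diam Λ / 2) ⊆ densitySupport f

end Noise

section Dynamics

variable {d : ℕ} {Λ : Set (Euc d)}

/-- Distinct states whose bi-infinite trajectories have summable distances. -/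
def StronglyHomoclinic (F : Equiv.Perm Λ) (x x' : Λ) : Prop :=
  x ≠ x' ∧ Summable (fun i : ℤ => ‖(((F ^ i) x : Λ) : Euc d) - (((F ^ i) x' : Λ) : Euc d)‖)

/-- `(X, X')`, defined on the probability space `(Ω, P)`, is a homoclinic coupling for the
map `F` and the measure `μ`. -/
structure IsHomoclinicCoupling {Ω : Type*} [MeasurableSpace Ω] (F : Equiv.Perm Λ) (μ : Measure Λ)
    (P : Measure Ω) (X X' : Ω → Λ) : Prop where
  law_left : HasLaw X μ P
  law_right : HasLaw X' μ P
  homoclinic_pos : 0 < P {ω | StronglyHomoclinic F (X ω) (X' ω)}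

/-- A homoclinic coupling exists on some probability space. By
`IsHomoclinicCoupling.admits` below, the universe of that space is immaterial. -/
def AdmitsHomoclinicCoupling (F : Equiv.Perm Λ) (μ : Measure Λ) : Prop :=
  ∃ (Ω : Type) (_ : MeasurableSpace Ω) (P : Measure Ω) (_ : IsProbabilityMeasure P)
    (X X' : Ω → Λ), IsHomoclinicCoupling F μ P X X'

theorem IsHomoclinicCoupling.admits {Ω : Type*} [MeasurableSpace Ω] {F : Equiv.Perm Λ}
    {μ : Measure Λ} {P : Measure Ω} [IsProbabilityMeasure P] {X X' : Ω → Λ}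
    (h : IsHomoclinicCoupling F μ P X X') : AdmitsHomoclinicCoupling F μ := by
  have hm : AEMeasurable (fun ω => (X ω, X' ω)) P :=
    h.law_left.aemeasurable.prodMk h.law_right.aemeasurable
  refine ⟨Λ × Λ, inferInstance, P.map (fun ω => (X ω, X' ω)),
    Measure.isProbabilityMeasure_map hm, Prod.fst, Prod.snd, ?_, ?_, ?_⟩
  · refine ⟨measurable_fst.aemeasurable, ?_⟩
    rw [AEMeasurable.map_map_of_aemeasurable measurable_fst.aemeasurable hm]
    exact h.law_left.map_eq
  · refine ⟨measurable_snd.aemeasurable, ?_⟩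
    rw [AEMeasurable.map_map_of_aemeasurable measurable_snd.aemeasurable hm]
    exact h.law_right.map_eq
  · exact lt_of_lt_of_le h.homoclinic_pos
      (Measure.le_map_apply hm {p : Λ × Λ | StronglyHomoclinic F p.1 p.2})

/-- The states `X_i = F^i X`, `i ∈ ℤ`. -/
def stateProcess {Ω : Type*} (F : Equiv.Perm Λ) (X : Ω → Λ) (i : ℤ) (ω : Ω) : Euc d :=
  (((F ^ i) (X ω) : Λ) : Euc d)

/-- The observations `Y_i = X_i + ε_i`, `i ∈ ℤ`. -/
def observedProcess {Ω : Type*} (F : Equiv.Perm Λ) (X : Ω → Λ) (ε : ℤ → Ω → Euc d)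
    (i : ℤ) (ω : Ω) : Euc d :=
  stateProcess F X i ω + ε i ω

end Dynamics

/-- A denoising procedure: measurable maps `ψ_{n,i} : (ℝ^d)^n → ℝ^d`, `i = 1, …, n`.
The index `i : Fin n` stands for `i + 1`; the case `n = 0` carries no data. -/
structure DenoisingProcedure (d : ℕ) where
  toFun : (n : ℕ) → Fin n → (Fin n → Euc d) → Euc d
  measurable : ∀ n i, Measurable (toFun n i)

/-- Weak consistency of `ψ` for the process `(X_i, Y_i)`:
`E [n⁻¹ ∑_{i=1}^n |ψ_{n,i}(Y_1, …, Y_n) - X_i|] → 0`, the expectations being `[0, ∞]`-valued. -/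
def DenoisingProcedure.WeaklyConsistent {d : ℕ} {Ω : Type*} [MeasurableSpace Ω]
    (ψ : DenoisingProcedure d) (P : Measure Ω) (X Y : ℤ → Ω → Euc d) : Prop :=
  Tendsto (fun n : ℕ =>
      ∫⁻ ω, (n : ENNReal)⁻¹ *
        ∑ i : Fin n, ‖ψ.toFun n i (fun j : Fin n => Y ((j : ℤ) + 1) ω) - X ((i : ℤ) + 1) ω‖ₑ ∂P)
    atTop (𝓝 0)

/-! Along a strongly homoclinic pair of orbits, the observations at time `k` have laws that are
translates of `η`, offset by a vector `z k`, with the norms summable. The two limsup conditions make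
the overlap of these translates at least `1 - C ‖z k‖` for small offsets, and the ball condition
keeps every overlap positive; so the product of overlaps over all times stays above some `c > 0`
(`exists_pos_le_prod_overlapMass`).

Thus the laws of any observation window started from the two orbits share mass `c`, and no estimator
can have total error below `c * ‖x - x'‖` for the two targets (`prod_overlapMass_mul_enorm_sub_le`).
Both coordinates of the coupling have law `μ`, so consistency would send the mean risk to zero at
each. Fatou's lemma then contradicts the pointwise bound on an event of positive probability. -/

/-- The mass `∫ min (f w) (f (w + z)) dw` shared by the law with density `f` and its
translate by `z`. -/
noncomputable def overlapMass {d : ℕ} (f : Euc d → ℝ) (z : Euc d) : ENNReal :=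
  ∫⁻ w, min (ENNReal.ofReal (f w)) (ENNReal.ofReal (f (w + z)))

/-! ### Overlap of the noise law with a translate -/

section Overlap

variable {d : ℕ} {η : Measure (Euc d)} {f : Euc d → ℝ}

theorem IsLebesgueDensity.measurableSet_densitySupport (hf : IsLebesgueDensity η f) :
    MeasurableSet (densitySupport f) :=
  measurableSet_lt measurable_const hf.measurable

theorem IsLebesgueDensity.lintegral_eq_one [IsProbabilityMeasure η] (hf : IsLebesgueDensity η f) :
    ∫⁻ w, ENNReal.ofReal (f w) = 1 := by
  have h : η Set.univ = 1 := measure_univ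
  rwa [hf.eq_withDensity, withDensity_apply _ MeasurableSet.univ, setLIntegral_univ] at h

theorem overlapMass_le_one [IsProbabilityMeasure η] (hf : IsLebesgueDensity η f) (z : Euc d) :
    overlapMass f z ≤ 1 :=
  (lintegral_mono fun _ => min_le_left _ _).trans hf.lintegral_eq_one.le

theorem overlapMass_pos (hf : IsLebesgueDensity η f) {ρ : ℝ} (hρ : 0 < ρ)
    (hS : Metric.ball (0 : Euc d) (3 * ρ / 2) ⊆ densitySupport f) {z : Euc d} (hz : ‖z‖ ≤ ρ) :
    0 < overlapMass f z := by
  have hm : Measurable fun w : Euc d => min (ENNReal.ofReal (f w)) (ENNReal.ofReal (f (w + z))) :=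
    hf.measurable.ennreal_ofReal.min
      (hf.measurable.comp (measurable_id.add_const z)).ennreal_ofReal
  rw [overlapMass, lintegral_pos_iff_support hm]
  -- On the ball of radius `ρ / 2`, both `w` and `w + z` stay within `3 * ρ / 2` of the origin.
  refine (Metric.measure_ball_pos volume (0 : Euc d) (half_pos hρ)).trans_le (measure_mono ?_)
  intro w hw
  rw [mem_ball_zero_iff] at hw
  have h1 : 0 < f w := hS (by rw [mem_ball_zero_iff]; linarith)
  have h2 : 0 < f (w + z) := hS (by
    rw [mem_ball_zero_iff]
    linarith [norm_add_le w z])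
  exact (lt_min (ENNReal.ofReal_pos.2 h1) (ENNReal.ofReal_pos.2 h2)).ne'

/-- A segment is connected, so it cannot pass from `S` to its complement without meeting the
frontier. -/
theorem exists_mem_frontier_dist_le {S : Set (Euc d)} {w z : Euc d} (hw : w ∈ S)
    (hwz : w + z ∉ S) : ∃ v ∈ frontier S, dist w v ≤ ‖z‖ := by
  have hpre : IsPreconnected (segment ℝ w (w + z)) := (convex_segment _ _).isPreconnected
  obtain ⟨v, hv, hvS⟩ : (segment ℝ w (w + z) ∩ frontier S).Nonempty := by
    by_contra hne
    have hne' : Disjoint (segment ℝ w (w + z)) (frontier S) :=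
      Set.disjoint_iff_inter_eq_empty.2 (Set.not_nonempty_iff_eq_empty.1 hne)
    have hw' := left_mem_segment ℝ w (w + z)
    have hwz' := right_mem_segment ℝ w (w + z)
    obtain ⟨u, hu⟩ := hpre (interior S) (interior Sᶜ) isOpen_interior isOpen_interior
      (fun u hu => by
        by_contra h
        rw [Set.mem_union, not_or, interior_compl, Set.notMem_compl_iff] at h
        exact Set.disjoint_left.1 hne' hu ⟨h.2, h.1⟩)
      ⟨w, hw', by
        by_contra h
        exact Set.disjoint_left.1 hne' hw' ⟨subset_closure hw, h⟩⟩
      ⟨w + z, hwz', by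
        rw [interior_compl]
        exact fun h => Set.disjoint_left.1 hne' hwz' ⟨h, fun h' => hwz (interior_subset h')⟩⟩
    exact interior_subset hu.2.2 (interior_subset hu.2.1)
  refine ⟨v, hvS, ?_⟩
  rw [segment_eq_image'] at hv
  obtain ⟨t, ht, rfl⟩ := hv
  simp only [add_sub_cancel_left, dist_self_add_right, norm_smul, Real.norm_eq_abs,
    abs_of_nonneg ht.1]
  exact mul_le_of_le_one_left (norm_nonneg _) ht.2

theorem le_min_add_abs_log_mul {a b : ℝ} (ha : 0 < a) (hb : 0 < b) :
    a ≤ min a b + |Real.log (b / a)| * a := by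
  rcases le_total a b with h | h
  · rw [min_eq_left h]
    have := mul_nonneg (abs_nonneg (Real.log (b / a))) ha.le
    linarith
  · rw [min_eq_right h]
    have h2 : Real.log (b / a) ≤ b / a - 1 := Real.log_le_sub_one_of_pos (div_pos hb ha)
    have h3 : 1 - b / a ≤ |Real.log (b / a)| := by
      linarith [neg_le_abs (Real.log (b / a))]
    have h4 := mul_le_mul_of_nonneg_right h3 ha.le
    have h5 : (1 - b / a) * a = a - b := by field_simp
    linarith

/-- Pointwise, `f w` is covered by the minimum plus the log-ratio term if `w + z` is in the support,
and by the boundary layer otherwise. -/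
theorem one_le_overlapMass_add [IsProbabilityMeasure η] (hf : IsLebesgueDensity η f) {z : Euc d}
    (hz : z ≠ 0) :
    1 ≤ overlapMass f z +
      ((∫⁻ w in densitySupport f ∩ {w | w + z ∈ densitySupport f},
        ENNReal.ofReal (|Real.log (f (w + z) / f w)| * f w)) +
      η (Metric.thickening (2 * ‖z‖) (frontier (densitySupport f)))) := by
  have hfz : Measurable fun w : Euc d => f (w + z) :=
    hf.measurable.comp (measurable_id.add_const z)
  have hA : MeasurableSet (densitySupport f ∩ {w | w + z ∈ densitySupport f}) :=
    hf.measurableSet_densitySupport.inter (measurableSet_lt measurable_const hfz)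
  have hT : MeasurableSet (Metric.thickening (2 * ‖z‖) (frontier (densitySupport f))) :=
    Metric.isOpen_thickening.measurableSet
  have hm : Measurable fun w : Euc d => min (ENNReal.ofReal (f w)) (ENNReal.ofReal (f (w + z))) :=
    hf.measurable.ennreal_ofReal.min hfz.ennreal_ofReal
  have hη : η (Metric.thickening (2 * ‖z‖) (frontier (densitySupport f))) =
      ∫⁻ w in Metric.thickening (2 * ‖z‖) (frontier (densitySupport f)),
        ENNReal.ofReal (f w) := by
    conv_lhs => rw [hf.eq_withDensity]
    exact withDensity_apply _ hT
  rw [hη, ← lintegral_indicator hA, ← lintegral_indicator hT, overlapMass,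
    ← lintegral_add_right _ (hf.measurable.ennreal_ofReal.indicator hT), ← lintegral_add_left hm,
    ← hf.lintegral_eq_one]
  refine lintegral_mono fun w => ?_
  by_cases hw : 0 < f w
  · by_cases hwz : 0 < f (w + z)
    · rw [Set.indicator_of_mem (show w ∈ densitySupport f ∩ {w | w + z ∈ densitySupport f} from
        ⟨hw, hwz⟩), ← add_assoc]
      refine le_add_right ?_
      rw [← ENNReal.ofReal_min, ← ENNReal.ofReal_add (le_min hw.le hwz.le)
        (mul_nonneg (abs_nonneg _) hw.le)]
      exact ENNReal.ofReal_le_ofReal (le_min_add_abs_log_mul hw hwz)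
    · obtain ⟨v, hv, hwv⟩ := exists_mem_frontier_dist_le (S := densitySupport f) (w := w) hw hwz
      -- The frontier point may be at distance exactly `‖z‖`; doubling the radius gives the strict
      -- inequality an open thickening needs.
      rw [Set.indicator_of_mem (s := Metric.thickening _ _)
        (Metric.mem_thickening_iff.2 ⟨v, hv, by linarith [norm_pos_iff.2 hz]⟩)]
      exact le_add_left (le_add_left le_rfl)
  · simp [ENNReal.ofReal_of_nonpos (not_lt.1 hw)]

theorem exists_forall_one_le_overlapMass_add [IsProbabilityMeasure η]
    (hf : IsLebesgueDensity η f) (h1 : LogLipschitzOnAverage f) (h2 : BoundaryMassLinear η f) :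
    ∃ C : ℝ, 0 ≤ C ∧ ∃ δ > 0, ∀ z : Euc d, z ≠ 0 → ‖z‖ < δ →
      1 ≤ overlapMass f z + ENNReal.ofReal (C * ‖z‖) := by
  obtain ⟨C₁, hC₁, hC₁'⟩ := ENNReal.lt_iff_exists_nnreal_btwn.1 h1
  obtain ⟨C₂, hC₂, hC₂'⟩ := ENNReal.lt_iff_exists_nnreal_btwn.1 h2
  have e1 := eventually_lt_of_limsup_lt hC₁
  have e2 := eventually_lt_of_limsup_lt hC₂
  rw [eventually_nhdsWithin_iff, Metric.eventually_nhds_iff] at e1 e2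
  obtain ⟨δ₁, hδ₁, e1⟩ := e1
  obtain ⟨δ₂, hδ₂, e2⟩ := e2
  refine ⟨C₁ + C₂ * 2, by positivity, min δ₁ (δ₂ / 2), lt_min hδ₁ (half_pos hδ₂), ?_⟩
  intro z hz hzδ
  have hz0 : 0 < ‖z‖ := norm_pos_iff.2 hz
  have a1 := (e1 (y := z) (by simpa using hzδ.trans_le (min_le_left _ _)) hz).le
  have hz2 : ‖z‖ < δ₂ / 2 := hzδ.trans_le (min_le_right _ _)
  have a2 := (e2 (y := 2 * ‖z‖) (by
    rw [Real.dist_eq, sub_zero, abs_of_pos (by positivity)]; linarith)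
    (show (0 : ℝ) < 2 * ‖z‖ by positivity)).le
  rw [ENNReal.div_le_iff (ENNReal.ofReal_pos.2 hz0).ne' ENNReal.ofReal_ne_top] at a1
  rw [ENNReal.div_le_iff (ENNReal.ofReal_pos.2 (by positivity)).ne' ENNReal.ofReal_ne_top] at a2
  refine (one_le_overlapMass_add hf hz).trans (add_le_add le_rfl ((add_le_add a1 a2).trans ?_))
  rw [← ENNReal.ofReal_coe_nnreal, ← ENNReal.ofReal_coe_nnreal,
    ← ENNReal.ofReal_mul (by positivity), ← ENNReal.ofReal_mul (by positivity),
    ← ENNReal.ofReal_add (by positivity) (by positivity)]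
  exact ENNReal.ofReal_le_ofReal (by linarith)

end Overlap

/-! ### Lower bounds for products -/

theorem exists_pos_le_prod_of_summable_one_sub {ι : Type*} {m : ι → ℝ} (hpos : ∀ i, 0 < m i)
    (hsum : Summable fun i => 1 - m i) :
    ∃ c > 0, ∀ s : Finset ι, c ≤ ∏ i ∈ s, m i := by
  have hlog : Summable fun i => Real.log (m i) := by
    refine (Real.summable_log_one_add_of_summable hsum.neg).congr fun i => ?_
    congr 1; ring
  refine ⟨Real.exp (-∑' i, |Real.log (m i)|), Real.exp_pos _, fun s => ?_⟩
  rw [← Real.exp_log (Finset.prod_pos fun i _ => hpos i), Real.log_prod fun i _ => (hpos i).ne']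
  refine Real.exp_le_exp.2 ?_
  have h := hlog.abs.sum_le_tsum s fun i _ => abs_nonneg _
  have h' := Finset.abs_sum_le_sum_abs (fun i => Real.log (m i)) s
  linarith [neg_abs_le (∑ i ∈ s, Real.log (m i))]

theorem exists_pos_le_prod_overlapMass {d : ℕ} {η : Measure (Euc d)} {f : Euc d → ℝ}
    [IsProbabilityMeasure η] (hf : IsLebesgueDensity η f) (h1 : LogLipschitzOnAverage f)
    (h2 : BoundaryMassLinear η f) {ρ : ℝ} (hρ : 0 < ρ)
    (hS : Metric.ball (0 : Euc d) (3 * ρ / 2) ⊆ densitySupport f) {ι : Type*} {z : ι → Euc d}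
    (hz0 : ∀ i, z i ≠ 0) (hz : ∀ i, ‖z i‖ ≤ ρ) (hsum : Summable fun i => ‖z i‖) :
    ∃ c : ENNReal, c ≠ 0 ∧ ∀ s : Finset ι, c ≤ ∏ i ∈ s, overlapMass f (z i) := by
  obtain ⟨C, hC, δ, hδ, hCδ⟩ := exists_forall_one_le_overlapMass_add hf h1 h2
  have hle : ∀ i, overlapMass f (z i) ≤ 1 := fun i => overlapMass_le_one hf _
  have htop : ∀ i, overlapMass f (z i) ≠ ⊤ := fun i => ((hle i).trans_lt ENNReal.one_lt_top).ne
  have hsum' : Summable fun i => 1 - (overlapMass f (z i)).toReal := by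
    refine (hsum.mul_left C).of_norm_bounded_eventually ?_
    -- Only finitely many offsets have norm at least `δ`; they do not affect summability.
    filter_upwards [hsum.tendsto_cofinite_zero.eventually (gt_mem_nhds hδ)] with i hi
    have h := hCδ (z i) (hz0 i) hi
    rw [← ENNReal.ofReal_toReal (htop i), ← ENNReal.ofReal_add ENNReal.toReal_nonneg
      (by positivity), ENNReal.one_le_ofReal] at h
    have h' := ENNReal.toReal_mono ENNReal.one_ne_top (hle i)
    rw [ENNReal.toReal_one] at h'
    rw [Real.norm_of_nonneg (by linarith)]
    linarith
  obtain ⟨c, hc, hprod⟩ := exists_pos_le_prod_of_summable_one_sub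
    (fun i => ENNReal.toReal_pos (overlapMass_pos hf hρ hS (hz i)).ne' (htop i)) hsum'
  refine ⟨ENNReal.ofReal c, (ENNReal.ofReal_pos.2 hc).ne', fun s => ?_⟩
  refine (ENNReal.ofReal_le_ofReal (hprod s)).trans_eq ?_
  rw [ENNReal.ofReal_prod_of_nonneg fun i _ => ENNReal.toReal_nonneg]
  exact Finset.prod_congr rfl fun i _ => ENNReal.ofReal_toReal (htop i)

/-- The product measure comes from the largest outer measure bounded on boxes by the product of the
factors, so comparison on boxes suffices. -/
theorem MeasureTheory.Measure.pi_mono {ι : Type*} [Fintype ι] {α : ι → Type*}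
    [∀ i, MeasurableSpace (α i)] {μ ν : ∀ i, Measure (α i)} [∀ i, SigmaFinite (μ i)]
    (h : ∀ i, μ i ≤ ν i) : Measure.pi μ ≤ Measure.pi ν := by
  have key : (Measure.pi μ).toOuterMeasure ≤
      OuterMeasure.pi fun i => (ν i).toOuterMeasure := by
    rw [OuterMeasure.le_pi]
    intro s _
    exact (Measure.pi_pi μ s).le.trans (Finset.prod_le_prod' fun i _ => h i (s i))
  intro s
  rw [Measure.pi_def ν]
  exact (key s).trans (le_toMeasure_apply _ _ s)

/-! ### Two-point lower bound for estimators -/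

section Translates

variable {d : ℕ} {η : Measure (Euc d)} {f : Euc d → ℝ}

/-- The measure with density `min (f (y - a)) (f (y - b))`, a common lower bound for the
translates by `a` and by `b` of the law with density `f`. -/
noncomputable def overlapMeasure (f : Euc d → ℝ) (a b : Euc d) : Measure (Euc d) :=
  volume.withDensity fun y => min (ENNReal.ofReal (f (y - a))) (ENNReal.ofReal (f (y - b)))

theorem overlapMeasure_comm (f : Euc d → ℝ) (a b : Euc d) :
    overlapMeasure f a b = overlapMeasure f b a := by
  simp only [overlapMeasure, min_comm]

theorem overlapMeasure_le_map (hf : IsLebesgueDensity η f) (a b : Euc d) :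
    overlapMeasure f a b ≤ η.map fun w => a + w := by
  refine Measure.le_iff.2 fun s hs => ?_
  have ha : Measurable fun w : Euc d => a + w := measurable_const_add a
  rw [overlapMeasure, withDensity_apply _ hs, Measure.map_apply ha hs]
  conv_rhs => rw [hf.eq_withDensity]
  rw [withDensity_apply _ (ha hs), ← lintegral_indicator hs, ← lintegral_indicator (ha hs),
    ← lintegral_add_left_eq_self _ a]
  refine lintegral_mono fun w => ?_
  by_cases hw : a + w ∈ s
  · rw [Set.indicator_of_mem hw, Set.indicator_of_mem (show w ∈ (fun w => a + w) ⁻¹' s from hw)]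
    simp
  · rw [Set.indicator_of_notMem hw]
    exact zero_le

theorem overlapMeasure_univ (f : Euc d → ℝ) (a b : Euc d) :
    overlapMeasure f a b Set.univ = overlapMass f (a - b) := by
  rw [overlapMeasure, withDensity_apply _ MeasurableSet.univ, setLIntegral_univ, overlapMass,
    ← lintegral_add_left_eq_self _ a]
  refine lintegral_congr fun w => ?_
  rw [add_sub_cancel_left, show a + w - b = w + (a - b) by abel]

theorem isFiniteMeasure_overlapMeasure [IsProbabilityMeasure η] (hf : IsLebesgueDensity η f)
    (a b : Euc d) : IsFiniteMeasure (overlapMeasure f a b) :=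
  ⟨by
    rw [overlapMeasure_univ]
    exact (overlapMass_le_one hf _).trans_lt ENNReal.one_lt_top⟩

/-- An estimator sees the translates of `η` by the vectors `a j`; no estimate separates two
targets better than the overlap of the two laws allows. -/
theorem prod_overlapMass_mul_enorm_sub_le [IsProbabilityMeasure η] (hf : IsLebesgueDensity η f)
    {ι : Type*} [Fintype ι] (a b : ι → Euc d) {g : (ι → Euc d) → Euc d} (hg : Measurable g)
    (u v : Euc d) :
    (∏ j, overlapMass f (a j - b j)) * ‖u - v‖ₑ ≤
      (∫⁻ e, ‖g (fun j => a j + e j) - u‖ₑ ∂Measure.pi fun _ : ι => η) +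
        ∫⁻ e, ‖g (fun j => b j + e j) - v‖ₑ ∂Measure.pi fun _ : ι => η := by
  have hfin : ∀ j, IsFiniteMeasure (overlapMeasure f (a j) (b j)) := fun j =>
    isFiniteMeasure_overlapMeasure hf _ _
  have hmap : ∀ c : ι → Euc d, ∀ j, IsProbabilityMeasure (η.map fun w => c j + w) := fun c j =>
    Measure.isProbabilityMeasure_map (measurable_const_add _).aemeasurable
  have hmeas : ∀ w : Euc d, Measurable fun y => ‖g y - w‖ₑ := fun w => (hg.sub_const w).enorm
  have hint : ∀ (c : ι → Euc d) (w : Euc d),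
      ∫⁻ e, ‖g (fun j => c j + e j) - w‖ₑ ∂Measure.pi (fun _ : ι => η) =
        ∫⁻ y, ‖g y - w‖ₑ ∂Measure.pi fun j => η.map fun w => c j + w := by
    intro c w
    have := hmap c
    rw [← Measure.pi_map_pi fun j => (measurable_const_add (c j)).aemeasurable,
      lintegral_map (hmeas w)
        (measurable_pi_lambda _ fun j => (measurable_pi_apply j).const_add (c j))]
  have hle : ∀ c : ι → Euc d,
      (∀ j, overlapMeasure f (a j) (b j) ≤ η.map fun w => c j + w) → ∀ w : Euc d,
      ∫⁻ y, ‖g y - w‖ₑ ∂Measure.pi (fun j => overlapMeasure f (a j) (b j)) ≤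
        ∫⁻ e, ‖g (fun j => c j + e j) - w‖ₑ ∂Measure.pi fun _ : ι => η := by
    intro c hc w
    rw [hint c w]
    exact lintegral_mono' (Measure.pi_mono hc) le_rfl
  calc (∏ j, overlapMass f (a j - b j)) * ‖u - v‖ₑ
      = ∫⁻ _, ‖u - v‖ₑ ∂Measure.pi fun j => overlapMeasure f (a j) (b j) := by
        rw [lintegral_const, Measure.pi_univ, mul_comm]
        simp only [overlapMeasure_univ]
    _ ≤ ∫⁻ y, (‖g y - u‖ₑ + ‖g y - v‖ₑ) ∂Measure.pi fun j => overlapMeasure f (a j) (b j) := by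
        refine lintegral_mono fun y => ?_
        rw [← edist_eq_enorm_sub, ← edist_eq_enorm_sub, ← edist_eq_enorm_sub]
        exact edist_triangle_left u v (g y)
    _ = _ := lintegral_add_left (hmeas u) _
    _ ≤ _ := add_le_add (hle a (fun j => overlapMeasure_le_map hf _ _) u)
        (hle b (fun j => overlapMeasure_comm f (a j) (b j) ▸ overlapMeasure_le_map hf _ _) v)

end Translates

/-! ### Risk as a function of the state -/

section Risk

variable {d : ℕ} {Λ : Set (Euc d)}

theorem measurable_perm_zpow (hΛ : IsCompact Λ) {F : Equiv.Perm Λ} (hF : Measurable F) (k : ℤ) :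
    Measurable (F ^ k) := by
  have : StandardBorelSpace Λ := hΛ.measurableSet.standardBorel
  have hnat : ∀ {G : Equiv.Perm Λ}, Measurable G → ∀ n : ℕ, Measurable (G ^ n) := by
    intro G hG n
    rw [Equiv.Perm.coe_pow]
    exact hG.iterate n
  have hinv : Measurable (F⁻¹ : Equiv.Perm Λ) := by
    intro s hs
    have h : (F⁻¹ : Equiv.Perm Λ) ⁻¹' s = F '' s := (F.image_eq_preimage_symm s).symm
    rw [h]
    -- Lusin–Souslin: an injective measurable map between standard Borel spaces has measurable
    -- images.
    exact (hF.measurableEmbedding F.injective).measurableSet_image' hs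
  obtain ⟨n, rfl | rfl⟩ := k.eq_nat_or_neg
  · rw [zpow_natCast]
    exact hnat hF n
  · rw [zpow_neg, zpow_natCast, ← inv_pow]
    exact hnat hinv n

/-- The expected error of the `i`-th of the `n` estimates, when the state at the estimated time
is `x`. -/
noncomputable def DenoisingProcedure.risk (ψ : DenoisingProcedure d) (F : Equiv.Perm Λ)
    (η : Measure (Euc d)) (n : ℕ) (i : Fin n) (x : Λ) : ENNReal :=
  ∫⁻ e, ‖ψ.toFun n i (fun j => (((F ^ ((j : ℤ) - (i : ℤ))) x : Λ) : Euc d) + e j) - (x : Euc d)‖ₑ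
    ∂Measure.pi fun _ : Fin n => η

/-- The average of the risks of the `n` estimates. -/
noncomputable def DenoisingProcedure.averageRisk (ψ : DenoisingProcedure d) (F : Equiv.Perm Λ)
    (η : Measure (Euc d)) (n : ℕ) (x : Λ) : ENNReal :=
  (n : ENNReal)⁻¹ * ∑ i : Fin n, ψ.risk F η n i x

variable {F : Equiv.Perm Λ} {η : Measure (Euc d)} (ψ : DenoisingProcedure d)

theorem DenoisingProcedure.measurable_error (hΛ : IsCompact Λ) (hF : Measurable F) (n : ℕ)
    (i : Fin n) (k : Fin n → ℤ) (l : ℤ) :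
    Measurable fun p : Λ × (Fin n → Euc d) =>
      ‖ψ.toFun n i (fun j => (((F ^ k j) p.1 : Λ) : Euc d) + p.2 j) -
        (((F ^ l) p.1 : Λ) : Euc d)‖ₑ := by
  have hpow : ∀ k : ℤ, Measurable fun p : Λ × (Fin n → Euc d) => (((F ^ k) p.1 : Λ) : Euc d) :=
    fun k => measurable_subtype_coe.comp ((measurable_perm_zpow hΛ hF k).comp measurable_fst)
  refine Measurable.enorm (Measurable.sub ((ψ.measurable n i).comp ?_) (hpow l))
  exact measurable_pi_lambda _ fun j =>
    (hpow (k j)).add ((measurable_pi_apply j).comp measurable_snd)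

theorem DenoisingProcedure.measurable_risk [SigmaFinite η] (hΛ : IsCompact Λ)
    (hF : Measurable F) (n : ℕ) (i : Fin n) : Measurable (ψ.risk F η n i) := by
  have h := ψ.measurable_error hΛ hF n i (fun j => (j : ℤ) - (i : ℤ)) 0
  simp only [zpow_zero, Equiv.Perm.coe_one, id_eq] at h
  exact h.lintegral_prod_right'

theorem DenoisingProcedure.measurable_averageRisk [SigmaFinite η] (hΛ : IsCompact Λ)
    (hF : Measurable F) (n : ℕ) : Measurable (ψ.averageRisk F η n) :=
  (Finset.measurable_sum _ fun i _ => ψ.measurable_risk hΛ hF n i).const_mul _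

/-- Independence factors the joint law of state and noise, and invariance of `μ` lets the state at
time `i + 1` be recentred to time `0`. -/
theorem DenoisingProcedure.lintegral_averageRisk {μ : Measure Λ} [IsProbabilityMeasure μ]
    [IsProbabilityMeasure η] (hΛ : IsCompact Λ) (hF : MeasurePreserving F μ μ)
    {Ω : Type*} [MeasurableSpace Ω] {P : Measure Ω} [IsProbabilityMeasure P]
    {X : Ω → Λ} {ε : ℤ → Ω → Euc d} (hX : HasLaw X μ P) (hε : ∀ i, HasLaw (ε i) η P)
    (hε_indep : iIndepFun ε P) (hXε : IndepFun X (fun ω i => ε i ω) P) (n : ℕ) :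
    ∫⁻ ω, (n : ENNReal)⁻¹ * ∑ i : Fin n,
        ‖ψ.toFun n i (fun j : Fin n => observedProcess F X ε ((j : ℤ) + 1) ω) -
          stateProcess F X ((i : ℤ) + 1) ω‖ₑ ∂P =
      ∫⁻ x, ψ.averageRisk F η n x ∂μ := by
  have hεn : HasLaw (fun ω (j : Fin n) => ε ((j : ℤ) + 1) ω) (Measure.pi fun _ : Fin n => η) P := by
    refine iIndepFun.hasLaw_pi (fun j => hε _)
      (hε_indep.precomp (g := fun j : Fin n => (j : ℤ) + 1) fun j k h => ?_)
    exact Fin.ext (by simpa using h)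
  have hind : IndepFun X (fun ω (j : Fin n) => ε ((j : ℤ) + 1) ω) P :=
    hXε.comp (φ := id) (ψ := fun (e : ℤ → Euc d) (j : Fin n) => e ((j : ℤ) + 1)) measurable_id
      (measurable_pi_lambda _ fun j => measurable_pi_apply _)
  have hjoint : HasLaw (fun ω => (X ω, fun j : Fin n => ε ((j : ℤ) + 1) ω))
      (μ.prod (Measure.pi fun _ : Fin n => η)) P :=
    (indepFun_iff_hasLaw_prodMk_prod hX hεn).1 hind
  have herr := fun i : Fin n =>
    ψ.measurable_error hΛ hF.measurable n i (fun j => (j : ℤ) + 1) ((i : ℤ) + 1)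
  have hsingle : ∀ i : Fin n,
      ∫⁻ p, ‖ψ.toFun n i (fun j => (((F ^ ((j : ℤ) + 1)) p.1 : Λ) : Euc d) + p.2 j) -
        (((F ^ ((i : ℤ) + 1)) p.1 : Λ) : Euc d)‖ₑ ∂μ.prod (Measure.pi fun _ : Fin n => η) =
      ∫⁻ x, ψ.risk F η n i x ∂μ := by
    intro i
    rw [lintegral_prod _ (herr i).aemeasurable,
      ← (hF.iterate (i + 1)).lintegral_comp (ψ.measurable_risk hΛ hF.measurable n i)]
    refine lintegral_congr fun x => ?_
    have hx : F^[(i : ℕ) + 1] x = (F ^ ((i : ℤ) + 1)) x := by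
      rw [← Equiv.Perm.coe_pow, ← zpow_natCast]
      push_cast
      rfl
    rw [hx, DenoisingProcedure.risk]
    simp only [← Equiv.Perm.mul_apply, ← zpow_add,
      show ∀ j : Fin n, (j : ℤ) - (i : ℤ) + ((i : ℤ) + 1) = (j : ℤ) + 1 from fun j => by ring]
  calc _ = ∫⁻ p, (n : ENNReal)⁻¹ * ∑ i : Fin n,
          ‖ψ.toFun n i (fun j => (((F ^ ((j : ℤ) + 1)) p.1 : Λ) : Euc d) + p.2 j) -
            (((F ^ ((i : ℤ) + 1)) p.1 : Λ) : Euc d)‖ₑ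
          ∂μ.prod (Measure.pi fun _ : Fin n => η) :=
        hjoint.lintegral_comp
          ((Finset.measurable_sum _ fun i _ => herr i).const_mul _).aemeasurable
    _ = _ := by
        unfold DenoisingProcedure.averageRisk
        rw [lintegral_const_mul _ (Finset.measurable_sum _ fun i _ => herr i),
          lintegral_const_mul _ (Finset.measurable_sum _ fun i _ =>
            ψ.measurable_risk hΛ hF.measurable n i),
          lintegral_finsetSum _ fun i _ => herr i,
          lintegral_finsetSum _ fun i _ => ψ.measurable_risk hΛ hF.measurable n i]
        simp only [hsingle]

theorem StronglyHomoclinic.exists_forall_le_averageRisk_add [IsProbabilityMeasure η]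
    (hΛ : IsCompact Λ) {f : Euc d → ℝ} (hf : IsLebesgueDensity η f)
    (h1 : LogLipschitzOnAverage f) (h2 : BoundaryMassLinear η f) (h3 : SupportContainsBall Λ f)
    {x x' : Λ} (h : StronglyHomoclinic F x x') :
    ∃ c : ENNReal, c ≠ 0 ∧ ∀ n : ℕ, n ≠ 0 → c ≤ ψ.averageRisk F η n x + ψ.averageRisk F η n x' := by
  obtain ⟨hne, hsum⟩ := h
  have hdist : ∀ a b : Λ, ‖(a : Euc d) - b‖ ≤ Metric.diam Λ := fun a b => by
    rw [← dist_eq_norm]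
    exact Metric.dist_le_diam_of_mem hΛ.isBounded a.2 b.2
  have hsub : ∀ {a b : Λ}, a ≠ b → (a : Euc d) - b ≠ 0 := fun hab =>
    sub_ne_zero.2 (Subtype.coe_injective.ne hab)
  obtain ⟨c, hc, hprod⟩ := exists_pos_le_prod_overlapMass hf h1 h2
    ((norm_pos_iff.2 (hsub hne)).trans_le (hdist x x')) h3
    (z := fun k : ℤ => (((F ^ k) x : Λ) : Euc d) - (((F ^ k) x' : Λ) : Euc d))
    (fun k => hsub ((F ^ k).injective.ne hne)) (fun k => hdist _ _) hsum
  refine ⟨c * ‖(x : Euc d) - x'‖ₑ, mul_ne_zero hc (enorm_ne_zero.2 (hsub hne)), fun n hn => ?_⟩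
  have hrisk : ∀ i : Fin n, c * ‖(x : Euc d) - x'‖ₑ ≤ ψ.risk F η n i x + ψ.risk F η n i x' := by
    intro i
    refine le_trans (mul_le_mul_left ?_ _) (prod_overlapMass_mul_enorm_sub_le hf
      (fun j : Fin n => (((F ^ ((j : ℤ) - (i : ℤ))) x : Λ) : Euc d))
      (fun j : Fin n => (((F ^ ((j : ℤ) - (i : ℤ))) x' : Λ) : Euc d)) (ψ.measurable n i) x x')
    -- The shifted window is a finite set of integers, so one constant `c` serves all `n` and `i`.
    have hinj : Function.Injective fun j : Fin n => (j : ℤ) - (i : ℤ) := fun j k hjk =>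
      Fin.ext (by simpa using hjk)
    refine (hprod (Finset.univ.map ⟨_, hinj⟩)).trans_eq ?_
    rw [Finset.prod_map]
    rfl
  rw [DenoisingProcedure.averageRisk, DenoisingProcedure.averageRisk, ← mul_add,
    ← Finset.sum_add_distrib]
  calc c * ‖(x : Euc d) - x'‖ₑ
      = (n : ENNReal)⁻¹ * ∑ _i : Fin n, c * ‖(x : Euc d) - x'‖ₑ := by
        rw [Finset.sum_const, Finset.card_univ, Fintype.card_fin, nsmul_eq_mul, ← mul_assoc,
          ENNReal.inv_mul_cancel (Nat.cast_ne_zero.2 hn) (ENNReal.natCast_ne_top n), one_mul]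
    _ ≤ _ := by gcongr with i; exact hrisk i

end Risk

/-! ### Contradiction through the coupling -/

theorem mainTheorem4 {d : ℕ} (Λ : Set (Euc d)) (hΛ : IsCompact Λ)
    (F : Equiv.Perm Λ) (μ : Measure Λ) [IsProbabilityMeasure μ]
    (hF : Ergodic F μ) (hcoupling : AdmitsHomoclinicCoupling F μ)
    (η : Measure (Euc d)) [IsProbabilityMeasure η] (f : Euc d → ℝ)
    (hf : IsLebesgueDensity η f)
    (hcond1 : LogLipschitzOnAverage f)
    (hcond2 : BoundaryMassLinear η f)
    (hcond3 : SupportContainsBall Λ f)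
    {Ω : Type*} [MeasurableSpace Ω] (P : Measure Ω) [IsProbabilityMeasure P]
    (X : Ω → Λ) (ε : ℤ → Ω → Euc d)
    (hX : HasLaw X μ P)
    (hε : ∀ i, HasLaw (ε i) η P)
    (hε_indep : iIndepFun ε P)
    (hXε : IndepFun X (fun ω i => ε i ω) P) :
    ∀ ψ : DenoisingProcedure d,
      ¬ ψ.WeaklyConsistent P (stateProcess F X) (observedProcess F X ε) := by
  intro ψ hψ
  obtain ⟨Ω', _, P', _, U, U', hU, hU', hpos⟩ := hcoupling
  have hmeas : ∀ n, Measurable (ψ.averageRisk F η n) :=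
    fun n => ψ.measurable_averageRisk hΛ hF.measurable n
  have hlim : Tendsto (fun n => ∫⁻ x, ψ.averageRisk F η n x ∂μ) atTop (𝓝 0) :=
    hψ.congr fun n => ψ.lintegral_averageRisk hΛ hF.toMeasurePreserving hX hε hε_indep hXε n
  have hUU : AEMeasurable (fun ω => (U ω, U' ω)) P' := hU.aemeasurable.prodMk hU'.aemeasurable
  have hpair : ∀ n, Measurable fun p : Λ × Λ =>
      ψ.averageRisk F η n p.1 + ψ.averageRisk F η n p.2 := fun n =>
    ((hmeas n).comp measurable_fst).add ((hmeas n).comp measurable_snd)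
  have hsum : ∀ n, ∫⁻ p, (ψ.averageRisk F η n p.1 + ψ.averageRisk F η n p.2)
        ∂P'.map (fun ω => (U ω, U' ω)) =
      ∫⁻ x, ψ.averageRisk F η n x ∂μ + ∫⁻ x, ψ.averageRisk F η n x ∂μ := fun n => by
    have hfst : Measurable fun p : Λ × Λ => ψ.averageRisk F η n p.1 :=
      (hmeas n).comp measurable_fst
    have hsnd : Measurable fun p : Λ × Λ => ψ.averageRisk F η n p.2 :=
      (hmeas n).comp measurable_snd
    rw [lintegral_add_left hfst, lintegral_map' hfst.aemeasurable hUU,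
      lintegral_map' hsnd.aemeasurable hUU]
    congr 1
    · exact hU.lintegral_comp (hmeas n).aemeasurable
    · exact hU'.lintegral_comp (hmeas n).aemeasurable
  -- The constant `c` depends on the pair, so the bound is passed to the limit pointwise, by Fatou.
  have hzero : ∫⁻ p, liminf
      (fun n => ψ.averageRisk F η n p.1 + ψ.averageRisk F η n p.2) atTop
        ∂P'.map (fun ω => (U ω, U' ω)) = 0 := by
    refine le_antisymm ((lintegral_liminf_le hpair).trans_eq ?_) zero_le
    simp only [hsum]
    simpa using (hlim.add hlim).liminf_eq
  rw [lintegral_eq_zero_iff (Measurable.liminf hpair)] at hzero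
  -- Homoclinic pairs lie in the null set where the liminf is nonzero, so the measurability of their
  -- set is not needed.
  refine hpos.ne' (measure_mono_null (fun ω hω => ?_) (ae_iff.1 (ae_of_ae_map hUU hzero)))
  obtain ⟨c, hc, hle⟩ := hω.exists_forall_le_averageRisk_add ψ hΛ hf hcond1 hcond2 hcond3
  intro h0
  have hc' : c ≤ liminf
      (fun n => ψ.averageRisk F η n (U ω) + ψ.averageRisk F η n (U' ω)) atTop :=
    le_liminf_of_le (by isBoundedDefault) ((eventually_ne_atTop 0).mono hle)
  exact hc (le_antisymm (hc'.trans_eq h0) zero_le)
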